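/- Let $X,Y,Z$ be the Pauli matrices, $H=\frac{1}{\sqrt2}\begin{pmatrix}1&1\\1&-1\end{pmatrix}$ the Hadamard gate, and let $\mathcal P_k$ be the $k$-qubit Pauli group, i.e. the set of all $P_1\otimes\cdots\otimes P_k$ with each $P_j\in\{i^\ell P : P\in\{I,X,Y,Z\},\ \ell\in\{0,1,2,3\}\}$. A unit vector $|\eta\rangle\in(\mathbb C^2)^{\otimes k}$ is called a $k$-qubit stabilizer state if exactly $2^k$ elements $P\in\mathcal P_k$ satisfy $P|\eta\rangle=|\eta\rangle$. If $k$ is odd, then every $k$-qubit stabilizer state $|\eta\rangle$ satisfies $|\langle\eta|H^{\otimes k}|\eta\rangle|\le \frac{1}{\sqrt2}$. If $k$ is even, then there exists a $k$-qubit stabilizer state $|\eta_0\rangle$ with $\langle\eta_0|H^{\otimes k}|\eta_0\rangle=1$; namely, one may take the product of Bell pairs $|\eta_0\rangle=|\Phi^+\rangle^{\otimes k/2}$, where $|\Phi^+\rangle=\frac{1}{\sqrt2}(|00\rangle+|11\rangle)$. -/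

import Mathlib

open scoped Matrix BigOperators

noncomputable section

namespace Stabilizer

/-- The vector space `(ℂ²)^{⊗n}` of `n` qubits, with its Hermitian inner product, written in the
computational basis, which is indexed by the bit strings `x ∈ {0,1}ⁿ`. -/
abbrev Qubits (n : ℕ) : Type := EuclideanSpace ℂ (Fin n → Fin 2)

/-- Linear operators on `n` qubits, as matrices in the computational basis. -/
abbrev Operator (n : ℕ) : Type := Matrix (Fin n → Fin 2) (Fin n → Fin 2) ℂ

/-- The computational basis state `|x⟩`. -/
def ket {n : ℕ} (x : Fin n → Fin 2) : Qubits n := EuclideanSpace.single x 1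

/-- The tensor product `A₁ ⊗ ⋯ ⊗ Aₙ` of single-qubit operators. -/
def tensor {n : ℕ} (A : Fin n → Matrix (Fin 2) (Fin 2) ℂ) : Operator n :=
  Matrix.of fun x y => ∏ i, A i (x i) (y i)

/-- The Pauli matrix `X`. -/
def pauliX : Matrix (Fin 2) (Fin 2) ℂ := !![0, 1; 1, 0]

/-- The Pauli matrix `Y`. -/
def pauliY : Matrix (Fin 2) (Fin 2) ℂ := !![0, -Complex.I; Complex.I, 0]

/-- The Pauli matrix `Z`. -/
def pauliZ : Matrix (Fin 2) (Fin 2) ℂ := !![1, 0; 0, -1]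

/-- The single-qubit Hadamard gate. -/
def hadamard : Matrix (Fin 2) (Fin 2) ℂ := ((1 / Real.sqrt 2 : ℝ) : ℂ) • !![1, 1; 1, -1]

/-- The single-qubit Pauli group `{i^ℓ P ∣ P ∈ {I, X, Y, Z}, ℓ ∈ {0,1,2,3}}` (as a set). -/
def pauliGroupOne : Set (Matrix (Fin 2) (Fin 2) ℂ) :=
  {A | ∃ ℓ : Fin 4, ∃ P ∈ ({1, pauliX, pauliY, pauliZ} : Set (Matrix (Fin 2) (Fin 2) ℂ)),
    A = Complex.I ^ (ℓ : ℕ) • P}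

/-- The `n`-qubit Pauli group (as a set): tensor products of `n` single-qubit Pauli group
elements. -/
def pauliGroup (n : ℕ) : Set (Operator n) :=
  {S | ∃ P : Fin n → Matrix (Fin 2) (Fin 2) ℂ, (∀ i, P i ∈ pauliGroupOne) ∧ S = tensor P}

/-- The stabilizer group of a vector `ψ`: the `n`-qubit Pauli operators `P` with `P ψ = ψ`. -/
def stab {n : ℕ} (ψ : Qubits n) : Set (Operator n) :=
  {P | P ∈ pauliGroup n ∧ P *ᵥ ψ.ofLp = ψ.ofLp}

/-- A pure state (unit vector) on `n` qubits is a stabilizer state if its stabilizer group has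
exactly `2ⁿ` elements. -/
def IsStabilizerState {n : ℕ} (ψ : Qubits n) : Prop :=
  ‖ψ‖ = 1 ∧ (stab ψ).ncard = 2 ^ n

/-- `⟨ψ| A |ψ⟩`. -/
def expectation {n : ℕ} (A : Operator n) (ψ : Qubits n) : ℂ :=
  inner ℂ ψ (WithLp.toLp 2 (A *ᵥ ψ.ofLp))

/-- `H^{⊗n}`. -/
def hadamardPower (n : ℕ) : Operator n := tensor fun _ => hadamard

/-- The Bell pair `Φ⁺ = (|00⟩ + |11⟩) / √2`. -/
def bellPair : Qubits 2 := ((1 / Real.sqrt 2 : ℝ) : ℂ) • (ket ![0, 0] + ket ![1, 1])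

/-- For even `k`, the tensor product `(Φ⁺)^{⊗ k/2}`, the `j`-th Bell pair being on the
(zero-based) qubits `2j` and `2j + 1`. -/
def bellPairs (k : ℕ) (_hk : Even k) : Qubits k :=
  WithLp.toLp 2 fun x => ∏ j : Fin (k / 2),
    bellPair ![x ⟨2 * j, by omega⟩, x ⟨2 * j + 1, by omega⟩]

end Stabilizer

end

/-!
# Hadamard expectation values of stabilizer states

Let `S` be the stabilizer group of a `k`-qubit stabilizer state `η`, and write `H`, `Y` for the
`k`-fold tensor powers of the Hadamard gate and of the Pauli matrix `Y`.

For a Pauli operator `P`, the sign in `P Y = ± Y P` is the parity of the number of tensor factors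
of `P` equal to `X` or `Z` up to phase. Since `H` exchanges `X` and `Z`, the same parity decides
whether `P` commutes or anticommutes with `Q = H P H` (`commutation_sign_of_mem_pauliGroup`). Let
`k` be odd, so that `H Y = -Y H`.

* If every element of `S` commutes with `Y`, then `η` is an eigenvector of `Y`, because `|η⟩⟨η|` is
  the average of `S` (`IsStabilizerState.eigenvector`). The eigenvalue is not zero, so
  `H Y = -Y H` forces `⟨η|H|η⟩ = 0`.
* Otherwise some `P ∈ S` anticommutes with `Q = H P H`. As `P η = η` and `Q H η = H η`, one has
  `2 ⟨η|H|η⟩ = ⟨η|(P + Q) H|η⟩`. Moreover `(P + Q)² = P² + Q² = 2`, so the right-hand side has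
  absolute value at most `√2` by the Cauchy–Schwarz inequality.

For even `k`, the operator `A ⊗ A` fixes `Φ⁺` for every `A` with `A Aᵀ = 1`
(`tensorPairs_mulVec_bellPairs`). With `A = X ^ a Z ^ b` this gives `4 ^ (k / 2) = 2 ^ k`
stabilizers of the product of Bell pairs, and with the Hadamard gate it gives the expectation
value `1`. A unit vector never has more than `2 ^ k` stabilizers: the squared Hilbert–Schmidt
distance between `|ψ⟩⟨ψ|` and `2 ^ (-k)` times the sum of the stabilizers is
`1 - |stab ψ| / 2 ^ k` (`trace_projector_sub`). This distance vanishes for a stabilizer state,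
which is also why `|η⟩⟨η|` is the average of `S`.
-/

namespace Stabilizer

/-! ### Tensor products of single-qubit operators -/

lemma tensor_mul {n : ℕ} (A B : Fin n → Matrix (Fin 2) (Fin 2) ℂ) :
    tensor A * tensor B = tensor fun i => A i * B i := by
  ext x y
  simp only [tensor, Matrix.mul_apply, Matrix.of_apply, ← Finset.prod_mul_distrib,
    Finset.prod_univ_sum, Fintype.piFinset_univ]

lemma conjTranspose_tensor {n : ℕ} (A : Fin n → Matrix (Fin 2) (Fin 2) ℂ) :
    (tensor A)ᴴ = tensor fun i => (A i)ᴴ := by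
  ext x y
  simp [tensor, Matrix.conjTranspose_apply]

lemma tensor_smul {n : ℕ} (c : Fin n → ℂ) (A : Fin n → Matrix (Fin 2) (Fin 2) ℂ) :
    (tensor fun i => c i • A i) = (∏ i, c i) • tensor A := by
  ext x y
  simp [tensor, Finset.prod_mul_distrib]

lemma tensor_one {n : ℕ} : (tensor fun _ : Fin n => 1) = 1 := by
  ext x y
  by_cases h : x = y
  · subst h
    simp [tensor, Matrix.one_apply_eq]
  · obtain ⟨i, hi⟩ := Function.ne_iff.1 h
    rw [Matrix.one_apply_ne h]
    exact Finset.prod_eq_zero (Finset.mem_univ i) (Matrix.one_apply_ne hi)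

lemma trace_tensor {n : ℕ} (A : Fin n → Matrix (Fin 2) (Fin 2) ℂ) :
    (tensor A).trace = ∏ i, (A i).trace := by
  simp only [tensor, Matrix.trace, Matrix.diag_apply, Matrix.of_apply, Finset.prod_univ_sum,
    Fintype.piFinset_univ]

/-! ### Single-qubit identities -/

lemma hadamard_mul_self : hadamard * hadamard = 1 := by
  have h : ((Real.sqrt 2 : ℝ) : ℂ) * (Real.sqrt 2 : ℝ) = 2 := by
    rw [← Complex.ofReal_mul, Real.mul_self_sqrt (by norm_num)]; norm_num
  have h' : ((Real.sqrt 2 : ℝ) : ℂ)⁻¹ * ((Real.sqrt 2 : ℝ) : ℂ)⁻¹ = 1 / 2 := by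
    rw [← mul_inv, h]; norm_num
  ext i j
  fin_cases i <;> fin_cases j <;>
    simp [hadamard, Matrix.mul_apply, Fin.sum_univ_two, h'] <;> norm_num

lemma transpose_hadamard : hadamardᵀ = hadamard := by
  ext i j
  fin_cases i <;> fin_cases j <;>
    simp [hadamard]

lemma conjTranspose_hadamard : hadamardᴴ = hadamard := by
  ext i j
  fin_cases i <;> fin_cases j <;>
    simp [hadamard, Matrix.conjTranspose_apply]

lemma hadamard_mul_pauliX : hadamard * pauliX = pauliZ * hadamard := by
  ext i j
  fin_cases i <;> fin_cases j <;>
    simp [hadamard, pauliX, pauliZ, Matrix.mul_apply, Fin.sum_univ_two]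

lemma hadamard_mul_pauliZ : hadamard * pauliZ = pauliX * hadamard := by
  ext i j
  fin_cases i <;> fin_cases j <;>
    simp [hadamard, pauliX, pauliZ, Matrix.mul_apply, Fin.sum_univ_two]

lemma hadamard_mul_pauliY : hadamard * pauliY = (-1 : ℂ) • (pauliY * hadamard) := by
  ext i j
  fin_cases i <;> fin_cases j <;>
    simp [hadamard, pauliY, Matrix.mul_apply, Fin.sum_univ_two] <;> ring

lemma pauliX_mul_self : pauliX * pauliX = 1 := by
  ext i j
  fin_cases i <;> fin_cases j <;> simp [pauliX, Matrix.mul_apply, Fin.sum_univ_two]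

lemma pauliY_mul_self : pauliY * pauliY = 1 := by
  ext i j
  fin_cases i <;> fin_cases j <;> simp [pauliY, Matrix.mul_apply, Fin.sum_univ_two]

lemma pauliZ_mul_self : pauliZ * pauliZ = 1 := by
  ext i j
  fin_cases i <;> fin_cases j <;> simp [pauliZ, Matrix.mul_apply, Fin.sum_univ_two]

lemma pauliX_mul_pauliY : pauliX * pauliY = Complex.I • pauliZ := by
  ext i j
  fin_cases i <;> fin_cases j <;> simp [pauliX, pauliY, pauliZ, Matrix.mul_apply, Fin.sum_univ_two]

lemma pauliY_mul_pauliX : pauliY * pauliX = Complex.I ^ 3 • pauliZ := by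
  ext i j
  fin_cases i <;> fin_cases j <;>
    simp [pauliX, pauliY, pauliZ, Matrix.mul_apply, Fin.sum_univ_two]

lemma pauliY_mul_pauliZ : pauliY * pauliZ = Complex.I • pauliX := by
  ext i j
  fin_cases i <;> fin_cases j <;> simp [pauliX, pauliY, pauliZ, Matrix.mul_apply, Fin.sum_univ_two]

lemma pauliZ_mul_pauliY : pauliZ * pauliY = Complex.I ^ 3 • pauliX := by
  ext i j
  fin_cases i <;> fin_cases j <;>
    simp [pauliX, pauliY, pauliZ, Matrix.mul_apply, Fin.sum_univ_two]

lemma pauliZ_mul_pauliX : pauliZ * pauliX = Complex.I • pauliY := by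
  ext i j
  fin_cases i <;> fin_cases j <;> simp [pauliX, pauliY, pauliZ, Matrix.mul_apply, Fin.sum_univ_two]

lemma pauliX_mul_pauliZ : pauliX * pauliZ = Complex.I ^ 3 • pauliY := by
  ext i j
  fin_cases i <;> fin_cases j <;>
    simp [pauliX, pauliY, pauliZ, Matrix.mul_apply, Fin.sum_univ_two]

lemma smul_mem_pauliGroupOne (m : ℕ) {A : Matrix (Fin 2) (Fin 2) ℂ} (hA : A ∈ pauliGroupOne) :
    Complex.I ^ m • A ∈ pauliGroupOne := by
  obtain ⟨l, P, hP, rfl⟩ := hA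
  refine ⟨⟨(m + l) % 4, Nat.mod_lt _ (by norm_num)⟩, P, hP, ?_⟩
  rw [smul_smul, ← pow_add, ← Complex.I_pow_eq_pow_mod]

lemma mem_pauliGroupOne {A : Matrix (Fin 2) (Fin 2) ℂ}
    (hA : A ∈ ({1, pauliX, pauliY, pauliZ} : Set (Matrix (Fin 2) (Fin 2) ℂ))) :
    A ∈ pauliGroupOne :=
  ⟨0, A, hA, by simp⟩

lemma mul_mem_pauliGroupOne {A B : Matrix (Fin 2) (Fin 2) ℂ} (hA : A ∈ pauliGroupOne)
    (hB : B ∈ pauliGroupOne) : A * B ∈ pauliGroupOne := by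
  obtain ⟨l, P, hP, rfl⟩ := hA
  obtain ⟨m, Q, hQ, rfl⟩ := hB
  have I1 : ∀ {C : Matrix (Fin 2) (Fin 2) ℂ}, C ∈ pauliGroupOne →
      Complex.I • C ∈ pauliGroupOne := fun h => by simpa using smul_mem_pauliGroupOne 1 h
  rw [smul_mul_smul_comm, ← pow_add]
  refine smul_mem_pauliGroupOne _ ?_
  rcases hP with rfl | rfl | rfl | rfl <;> rcases hQ with rfl | rfl | rfl | rfl <;>
    simp only [one_mul, mul_one, pauliX_mul_self, pauliY_mul_self, pauliZ_mul_self,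
      pauliX_mul_pauliY, pauliY_mul_pauliX, pauliY_mul_pauliZ, pauliZ_mul_pauliY,
      pauliX_mul_pauliZ, pauliZ_mul_pauliX] <;>
    first
      | exact I1 (mem_pauliGroupOne (by simp))
      | exact smul_mem_pauliGroupOne 3 (mem_pauliGroupOne (by simp))
      | exact mem_pauliGroupOne (by simp)

lemma conjTranspose_of_mem_pauliGroupOne {A : Matrix (Fin 2) (Fin 2) ℂ}
    (hA : A ∈ pauliGroupOne) :
    Aᴴ * A = 1 ∧ ∃ ε : ℂ, (ε = 1 ∨ ε = -1) ∧ Aᴴ = ε • A := by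
  obtain ⟨l, P, hP, rfl⟩ := hA
  have hPh : Pᴴ = P := by
    rcases hP with rfl | rfl | rfl | rfl
    · simp
    all_goals
      ext i j
      fin_cases i <;> fin_cases j <;>
        simp [pauliX, pauliY, pauliZ, Matrix.conjTranspose_apply]
  have hPP : P * P = 1 := by
    rcases hP with rfl | rfl | rfl | rfl
    exacts [one_mul 1, pauliX_mul_self, pauliY_mul_self, pauliZ_mul_self]
  constructor
  · rw [Matrix.conjTranspose_smul, hPh, smul_mul_smul_comm, hPP, star_pow, ← mul_pow]
    simp
  · refine ⟨(-1) ^ (l : ℕ), neg_one_pow_eq_or _ _, ?_⟩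
    rw [Matrix.conjTranspose_smul, hPh, smul_smul, star_pow, ← mul_pow]
    simp

lemma trace_of_mem_pauliGroupOne {A : Matrix (Fin 2) (Fin 2) ℂ} (hA : A ∈ pauliGroupOne) :
    A.trace = 0 ∨ ∃ c : ℂ, A = c • 1 := by
  obtain ⟨l, P, hP, rfl⟩ := hA
  rcases hP with rfl | rfl | rfl | rfl
  · exact Or.inr ⟨_, rfl⟩
  all_goals left; simp [pauliX, pauliY, pauliZ, Matrix.trace, Fin.sum_univ_two]

lemma commutation_sign_of_mem_pauliGroupOne {A : Matrix (Fin 2) (Fin 2) ℂ}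
    (hA : A ∈ pauliGroupOne) :
    ∃ ε : ℂ, (ε = 1 ∨ ε = -1) ∧ A * pauliY = ε • (pauliY * A) ∧
      A * (hadamard * A * hadamard) = ε • (hadamard * A * hadamard * A) := by
  obtain ⟨l, P, hP, rfl⟩ := hA
  simp only [Matrix.smul_mul, Matrix.mul_smul, smul_smul, mul_comm _ (Complex.I ^ (l : ℕ))]
  have I3 : Complex.I ^ 3 = -Complex.I := Complex.I_pow_three
  rcases hP with rfl | rfl | rfl | rfl
  · exact ⟨1, Or.inl rfl, by simp, by simp⟩
  · refine ⟨-1, Or.inr rfl, ?_, ?_⟩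
    · simp [pauliX_mul_pauliY, pauliY_mul_pauliX, I3]
    · rw [hadamard_mul_pauliX, Matrix.mul_assoc _ hadamard, hadamard_mul_self, mul_one,
        pauliX_mul_pauliZ, pauliZ_mul_pauliX, I3]
      simp
  · refine ⟨1, Or.inl rfl, by simp, ?_⟩
    rw [hadamard_mul_pauliY, Matrix.smul_mul, Matrix.mul_assoc _ hadamard, hadamard_mul_self]
    simp
  · refine ⟨-1, Or.inr rfl, ?_, ?_⟩
    · simp [pauliZ_mul_pauliY, pauliY_mul_pauliZ, I3]
    · rw [hadamard_mul_pauliZ, Matrix.mul_assoc _ hadamard, hadamard_mul_self, mul_one,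
        pauliX_mul_pauliZ, pauliZ_mul_pauliX, I3]
      simp

/-! ### The Pauli group -/

lemma prod_sign {n : ℕ} {ε : Fin n → ℂ} (h : ∀ i, ε i = 1 ∨ ε i = -1) :
    ∏ i, ε i = 1 ∨ ∏ i, ε i = -1 := by
  refine Finset.prod_induction _ (fun z : ℂ => z = 1 ∨ z = -1) ?_ (Or.inl rfl) fun i _ => h i
  rintro a b (rfl | rfl) (rfl | rfl) <;> simp

lemma finite_pauliGroup (n : ℕ) : (pauliGroup n).Finite := by
  have h1 : pauliGroupOne.Finite := by
    refine (Set.finite_range fun p : Fin 4 × ({1, pauliX, pauliY, pauliZ} :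
      Set (Matrix (Fin 2) (Fin 2) ℂ)) => Complex.I ^ (p.1 : ℕ) • p.2.1).subset ?_
    rintro _ ⟨l, P, hP, rfl⟩
    exact ⟨(l, ⟨P, hP⟩), rfl⟩
  refine ((Set.Finite.pi' fun _ : Fin n => h1).image tensor).subset ?_
  rintro _ ⟨P, hP, rfl⟩
  exact ⟨P, hP, rfl⟩

lemma mul_mem_pauliGroup {n : ℕ} {P Q : Operator n} (hP : P ∈ pauliGroup n)
    (hQ : Q ∈ pauliGroup n) : P * Q ∈ pauliGroup n := by
  obtain ⟨A, hA, rfl⟩ := hP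
  obtain ⟨B, hB, rfl⟩ := hQ
  exact ⟨_, fun i => mul_mem_pauliGroupOne (hA i) (hB i), tensor_mul A B⟩

lemma conjTranspose_of_mem_pauliGroup {n : ℕ} {P : Operator n} (hP : P ∈ pauliGroup n) :
    Pᴴ * P = 1 ∧ ∃ ε : ℂ, (ε = 1 ∨ ε = -1) ∧ Pᴴ = ε • P := by
  obtain ⟨A, hA, rfl⟩ := hP
  choose h1 ε hε h2 using fun i => conjTranspose_of_mem_pauliGroupOne (hA i)
  rw [conjTranspose_tensor]
  refine ⟨?_, ∏ i, ε i, prod_sign hε, ?_⟩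
  · rw [tensor_mul]
    simp only [h1, tensor_one]
  · simp only [h2, tensor_smul]

/-- A Pauli operator that is not a scalar is traceless. -/
lemma trace_of_mem_pauliGroup {n : ℕ} {P : Operator n} (hP : P ∈ pauliGroup n) :
    P.trace = 0 ∨ ∃ c : ℂ, P = c • 1 := by
  obtain ⟨A, hA, rfl⟩ := hP
  by_cases h : ∃ i, (A i).trace = 0
  · obtain ⟨i, hi⟩ := h
    left
    rw [trace_tensor]
    exact Finset.prod_eq_zero (Finset.mem_univ i) hi
  · push Not at h
    choose c hc using fun i => (trace_of_mem_pauliGroupOne (hA i)).resolve_left (h i)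
    refine Or.inr ⟨∏ i, c i, ?_⟩
    rw [funext hc, tensor_smul, tensor_one]

/-- The sign relating `P` and `Y ⊗ ⋯ ⊗ Y` also relates `P` and its conjugate by `H ⊗ ⋯ ⊗ H`:
both signs are the parity of the number of tensor factors of `P` that are `X` or `Z` up to phase. -/
lemma commutation_sign_of_mem_pauliGroup {n : ℕ} {P : Operator n} (hP : P ∈ pauliGroup n) :
    ∃ ε : ℂ, (ε = 1 ∨ ε = -1) ∧
      P * (tensor fun _ => pauliY) = ε • ((tensor fun _ => pauliY) * P) ∧
      P * (hadamardPower n * P * hadamardPower n) =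
        ε • (hadamardPower n * P * hadamardPower n * P) := by
  obtain ⟨A, hA, rfl⟩ := hP
  choose ε hε h1 h2 using fun i => commutation_sign_of_mem_pauliGroupOne (hA i)
  refine ⟨∏ i, ε i, prod_sign hε, ?_, ?_⟩
  · simp only [tensor_mul, h1, tensor_smul]
  · simp only [hadamardPower, tensor_mul, h2, tensor_smul]

lemma hadamardPower_mul_self (n : ℕ) : hadamardPower n * hadamardPower n = 1 := by
  simp only [hadamardPower, tensor_mul, hadamard_mul_self, tensor_one]

lemma conjTranspose_hadamardPower (n : ℕ) : (hadamardPower n)ᴴ = hadamardPower n := by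
  simp only [hadamardPower, conjTranspose_tensor, conjTranspose_hadamard]

lemma hadamardPower_mul_tensor_pauliY (n : ℕ) :
    hadamardPower n * (tensor fun _ => pauliY) =
      (-1 : ℂ) ^ n • ((tensor fun _ => pauliY) * hadamardPower n) := by
  simp only [hadamardPower, tensor_mul, hadamard_mul_pauliY]
  rw [tensor_smul]
  simp

/-! ### Stabilizers and expectation values -/

lemma expectation_eq {n : ℕ} (A : Operator n) (ψ : Qubits n) :
    expectation A ψ = star ψ.ofLp ⬝ᵥ (A *ᵥ ψ.ofLp) := by
  rw [expectation, EuclideanSpace.inner_eq_star_dotProduct, dotProduct_comm]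

lemma star_dotProduct_self {n : ℕ} {ψ : Qubits n} (hψ : ‖ψ‖ = 1) :
    star ψ.ofLp ⬝ᵥ ψ.ofLp = 1 := by
  have h := inner_self_eq_norm_sq_to_K (𝕜 := ℂ) ψ
  rw [EuclideanSpace.inner_eq_star_dotProduct, dotProduct_comm] at h
  simpa [hψ] using h

lemma ofLp_ne_zero {n : ℕ} {ψ : Qubits n} (hψ : ‖ψ‖ = 1) : ψ.ofLp ≠ 0 := by
  intro h
  have := star_dotProduct_self hψ
  simp [h] at this

lemma conjTranspose_of_mem_stab {n : ℕ} {ψ : Qubits n} (hψ : ‖ψ‖ = 1) {P : Operator n}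
    (hP : P ∈ stab ψ) : Pᴴ = P := by
  obtain ⟨h1, ε, hε, h2⟩ := conjTranspose_of_mem_pauliGroup hP.1
  rcases hε with rfl | rfl
  · rw [h2, one_smul]
  · -- `P` is then anti-Hermitian and unitary, so `ψ = Pᴴ P ψ = Pᴴ ψ = -P ψ = -ψ`.
    exfalso
    have h3 : Pᴴ *ᵥ ψ.ofLp = ψ.ofLp := by
      conv_lhs => rw [← hP.2]
      rw [Matrix.mulVec_mulVec, h1, Matrix.one_mulVec]
    rw [h2, Matrix.smul_mulVec, hP.2, neg_one_smul] at h3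
    exact ofLp_ne_zero hψ (self_eq_neg.1 h3.symm)

lemma mul_self_of_mem_stab {n : ℕ} {ψ : Qubits n} (hψ : ‖ψ‖ = 1) {P : Operator n}
    (hP : P ∈ stab ψ) : P * P = 1 := by
  have h := (conjTranspose_of_mem_pauliGroup hP.1).1
  rwa [conjTranspose_of_mem_stab hψ hP] at h

lemma trace_of_mem_stab {n : ℕ} {ψ : Qubits n} (hψ : ‖ψ‖ = 1) {P : Operator n}
    (hP : P ∈ stab ψ) (h1 : P ≠ 1) : P.trace = 0 := by
  refine (trace_of_mem_pauliGroup hP.1).resolve_right ?_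
  rintro ⟨c, rfl⟩
  have h := hP.2
  rw [Matrix.smul_mulVec, Matrix.one_mulVec] at h
  have hc : (c - 1) • ψ.ofLp = 0 := by rw [sub_smul, h, one_smul, sub_self]
  rcases smul_eq_zero.1 hc with hc | hc
  · exact h1 (by rw [sub_eq_zero.1 hc, one_smul])
  · exact ofLp_ne_zero hψ hc

lemma trace_mul_of_mem_stab {n : ℕ} {ψ : Qubits n} (hψ : ‖ψ‖ = 1) {P Q : Operator n}
    (hP : P ∈ stab ψ) (hQ : Q ∈ stab ψ) : (P * Q).trace = if P = Q then (2 : ℂ) ^ n else 0 := by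
  have hPP := mul_self_of_mem_stab hψ hP
  split_ifs with h
  · subst h
    rw [hPP, Matrix.trace_one]
    simp
  · refine trace_of_mem_stab hψ ⟨mul_mem_pauliGroup hP.1 hQ.1, ?_⟩ fun h1 => h ?_
    · rw [← Matrix.mulVec_mulVec, hQ.2, hP.2]
    · have := congrArg (P * ·) h1
      simp only [← Matrix.mul_assoc, hPP, one_mul, mul_one] at this
      exact this.symm

/-- The projector `|ψ⟩⟨ψ|`. -/
def projector {n : ℕ} (ψ : Qubits n) : Operator n := Matrix.vecMulVec ψ.ofLp (star ψ.ofLp)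

lemma projector_mulVec {n : ℕ} (ψ : Qubits n) (A : Operator n) :
    projector ψ *ᵥ (A *ᵥ ψ.ofLp) = expectation A ψ • ψ.ofLp := by
  rw [projector, Matrix.vecMulVec_mulVec, expectation_eq]
  ext; simp [mul_comm]

/-- The squared Hilbert–Schmidt norm of the difference between `|ψ⟩⟨ψ|` and the normalized sum of
a set of stabilizers; distinct stabilizers are orthogonal for the Hilbert–Schmidt inner product. -/
lemma trace_projector_sub {n : ℕ} {ψ : Qubits n} (hψ : ‖ψ‖ = 1) (S : Finset (Operator n))
    (hS : ∀ P ∈ S, P ∈ stab ψ) :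
    let D := projector ψ - ((2 : ℂ) ^ n)⁻¹ • ∑ P ∈ S, P
    (Dᴴ * D).trace = 1 - S.card / 2 ^ n := by
  intro D
  have hM : (projector ψ)ᴴ = projector ψ := by
    simp [projector, Matrix.conjTranspose_vecMulVec]
  have hDH : Dᴴ = D := by
    simp only [D, Matrix.conjTranspose_sub, hM, Matrix.conjTranspose_smul,
      Matrix.conjTranspose_sum, Finset.sum_congr rfl fun P hP =>
        conjTranspose_of_mem_stab hψ (hS P hP)]
    simp
  have hPM : ∀ P ∈ S, P * projector ψ = projector ψ := fun P hP => by
    rw [projector, Matrix.mul_vecMulVec, (hS P hP).2]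
  have hMP : ∀ P ∈ S, projector ψ * P = projector ψ := fun P hP => by
    have := congrArg Matrix.conjTranspose (hPM P hP)
    rwa [Matrix.conjTranspose_mul, hM, conjTranspose_of_mem_stab hψ (hS P hP)] at this
  have htr : (projector ψ).trace = 1 := by
    rw [projector, Matrix.trace_vecMulVec, dotProduct_comm, star_dotProduct_self hψ]
  have hMM : projector ψ * projector ψ = projector ψ := by
    rw [projector, Matrix.vecMulVec_mul_vecMulVec, star_dotProduct_self hψ, one_smul]
  have hSS : ((∑ P ∈ S, P) * ∑ P ∈ S, P).trace = S.card * (2 : ℂ) ^ n := by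
    rw [Finset.sum_mul_sum, Matrix.trace_sum]
    simp only [Matrix.trace_sum]
    rw [Finset.sum_congr rfl fun P hP => Finset.sum_congr rfl fun Q hQ =>
      trace_mul_of_mem_stab hψ (hS P hP) (hS Q hQ)]
    simp
  have hMS : (projector ψ * ∑ P ∈ S, P).trace = S.card := by
    rw [Finset.mul_sum, Finset.sum_congr rfl hMP, Matrix.trace_sum]
    simp [htr]
  have hSM : ((∑ P ∈ S, P) * projector ψ).trace = S.card := by
    rw [Matrix.trace_mul_comm, hMS]
  rw [hDH]
  simp only [D, sub_mul, mul_sub, Matrix.smul_mul, Matrix.mul_smul, Matrix.trace_sub,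
    Matrix.trace_smul, hMM, htr, hSS, hMS, hSM, smul_eq_mul]
  field_simp
  ring

open scoped ComplexOrder in
lemma ncard_stab_le {n : ℕ} {ψ : Qubits n} (hψ : ‖ψ‖ = 1) : (stab ψ).ncard ≤ 2 ^ n := by
  have hfin : (stab ψ).Finite := (finite_pauliGroup n).subset fun P hP => hP.1
  have h := trace_projector_sub hψ hfin.toFinset fun P hP => hfin.mem_toFinset.1 hP
  have h0 := (Matrix.posSemidef_conjTranspose_mul_self
    (projector ψ - ((2 : ℂ) ^ n)⁻¹ • ∑ P ∈ hfin.toFinset, P)).trace_nonneg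
  rw [h, ← Set.ncard_eq_toFinset_card _ hfin] at h0
  have h1 : (0 : ℝ) ≤ 1 - (stab ψ).ncard / 2 ^ n := by
    rw [← Complex.zero_le_real]
    push_cast
    exact h0
  rw [sub_nonneg, div_le_one (by positivity)] at h1
  exact_mod_cast h1

open scoped ComplexOrder in
lemma IsStabilizerState.projector_eq {n : ℕ} {ψ : Qubits n} (hψ : IsStabilizerState ψ) :
    ∃ S : Finset (Operator n), (∀ P ∈ S, P ∈ stab ψ) ∧
      projector ψ = ((2 : ℂ) ^ n)⁻¹ • ∑ P ∈ S, P := by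
  have hfin : (stab ψ).Finite := (finite_pauliGroup n).subset fun P hP => hP.1
  have hS : ∀ P ∈ hfin.toFinset, P ∈ stab ψ := fun P hP => hfin.mem_toFinset.1 hP
  have h := trace_projector_sub hψ.1 hfin.toFinset hS
  rw [← Set.ncard_eq_toFinset_card _ hfin, hψ.2] at h
  refine ⟨hfin.toFinset, hS, sub_eq_zero.1 (Matrix.trace_conjTranspose_mul_self_eq_zero_iff.1 ?_)⟩
  rw [h]
  simp

/-- A stabilizer state is an eigenvector of every operator that commutes with its stabilizer
group; the second identity says that the bra `⟨ψ|`
is a left eigenvector for the same eigenvalue. -/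
lemma IsStabilizerState.eigenvector {n : ℕ} {ψ : Qubits n} (hψ : IsStabilizerState ψ)
    {A : Operator n} (hA : ∀ P ∈ stab ψ, P * A = A * P) :
    A *ᵥ ψ.ofLp = expectation A ψ • ψ.ofLp ∧
      ∀ B : Operator n, expectation (A * B) ψ = expectation A ψ * expectation B ψ := by
  obtain ⟨S, hS, hM⟩ := hψ.projector_eq
  have hc : projector ψ * A = A * projector ψ := by
    rw [hM, Matrix.smul_mul, Matrix.mul_smul, Finset.sum_mul, Finset.mul_sum,
      Finset.sum_congr rfl fun P hP => hA P (hS P hP)]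
  have h1 : expectation 1 ψ = 1 := by
    rw [expectation_eq, Matrix.one_mulVec, star_dotProduct_self hψ.1]
  have key : ∀ B : Operator n,
      expectation (A * B) ψ • ψ.ofLp = expectation B ψ • (A *ᵥ ψ.ofLp) := fun B => by
    rw [← projector_mulVec, ← Matrix.mulVec_mulVec, Matrix.mulVec_mulVec, hc,
      ← Matrix.mulVec_mulVec, projector_mulVec, Matrix.mulVec_smul]
  have h2 : A *ᵥ ψ.ofLp = expectation A ψ • ψ.ofLp := by
    have := key 1
    rw [mul_one, h1, one_smul] at this
    exact this.symm
  refine ⟨h2, fun B => ?_⟩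
  have := key B
  rw [h2, smul_smul] at this
  rw [mul_comm]
  exact smul_left_injective ℂ (ofLp_ne_zero hψ.1) this

/-- Cauchy–Schwarz: `|⟨ψ|A|ψ⟩|² ≤ ‖A ψ‖² = ⟨ψ|Aᴴ A|ψ⟩`. -/
lemma norm_expectation_sq_le {n : ℕ} {ψ : Qubits n} (hψ : ‖ψ‖ = 1) {A : Operator n} {c : ℝ}
    (hA : Aᴴ * A = (c : ℂ) • 1) : ‖expectation A ψ‖ ^ 2 ≤ c := by
  have h := norm_inner_le_norm (𝕜 := ℂ) ψ (WithLp.toLp 2 (A *ᵥ ψ.ofLp))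
  rw [hψ, one_mul] at h
  have h2 : ((‖(WithLp.toLp 2 (A *ᵥ ψ.ofLp) : Qubits n)‖ : ℂ)) ^ 2 = c := by
    have h3 := inner_self_eq_norm_sq_to_K (𝕜 := ℂ) (WithLp.toLp 2 (A *ᵥ ψ.ofLp) : Qubits n)
    rw [EuclideanSpace.inner_eq_star_dotProduct, dotProduct_comm] at h3
    refine h3.symm.trans ?_
    simp only []
    rw [Matrix.star_mulVec, ← Matrix.dotProduct_mulVec, Matrix.mulVec_mulVec, hA,
      Matrix.smul_mulVec, Matrix.one_mulVec, dotProduct_smul, star_dotProduct_self hψ]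
    simp
  have h3 : ‖(WithLp.toLp 2 (A *ᵥ ψ.ofLp) : Qubits n)‖ ^ 2 = c := by exact_mod_cast h2
  rw [← h3]
  exact pow_le_pow_left₀ (norm_nonneg _) h 2

/-! ### Odd number of qubits -/

lemma norm_expectation_hadamardPower_le_of_odd {k : ℕ} (hk : Odd k) {η : Qubits k}
    (hη : IsStabilizerState η) : ‖expectation (hadamardPower k) η‖ ≤ 1 / Real.sqrt 2 := by
  set H := hadamardPower k with hH
  set Y : Operator k := tensor fun _ => pauliY with hY
  have hHH : H * H = 1 := hadamardPower_mul_self k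
  have hHstar : Hᴴ = H := conjTranspose_hadamardPower k
  by_cases hcomm : ∀ P ∈ stab η, P * Y = Y * P
  · -- `Y` acts on `η` as a nonzero scalar and anticommutes with `H`, so the expectation is zero.
    obtain ⟨h1, h2⟩ := hη.eigenvector hcomm
    have hYY : Y * Y = 1 := by
      simp only [hY, tensor_mul, pauliY_mul_self, tensor_one]
    have hHY : H * Y = (-1 : ℂ) • (Y * H) := by
      rw [hH, hY, hadamardPower_mul_tensor_pauliY, hk.neg_one_pow]
    have hc : expectation Y η * expectation Y η = 1 := by
      rw [← h2, hYY, expectation_eq, Matrix.one_mulVec, star_dotProduct_self hη.1]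
    have h3 : expectation (H * Y) η = expectation Y η * expectation H η := by
      rw [expectation_eq, ← Matrix.mulVec_mulVec, h1, Matrix.mulVec_smul, dotProduct_smul,
        ← expectation_eq, smul_eq_mul]
    have h4 : expectation (H * Y) η = -(expectation Y η * expectation H η) := by
      rw [hHY, expectation_eq, Matrix.smul_mulVec, dotProduct_smul, ← expectation_eq, h2,
        neg_one_smul]
    have h5 : expectation Y η * expectation H η = 0 := self_eq_neg.1 (h3.symm.trans h4)
    have h6 : expectation H η = 0 := by
      rcases mul_eq_zero.1 h5 with h | h
      · simp [h] at hc
      · exact h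
    rw [h6, norm_zero]
    positivity
  · -- Some stabilizer `P` of `η` anticommutes with the stabilizer `Q = H P H` of `H η`.
    push Not at hcomm
    obtain ⟨P, hP, hPY⟩ := hcomm
    obtain ⟨ε, hε, h1, h2⟩ := commutation_sign_of_mem_pauliGroup hP.1
    rcases hε with rfl | rfl
    · exact absurd (by rw [h1, one_smul]) hPY
    rw [← hH] at h2
    have hPP := mul_self_of_mem_stab hη.1 hP
    have hPstar := conjTranspose_of_mem_stab hη.1 hP
    set Q : Operator k := H * P * H with hQ
    have hQstar : Qᴴ = Q := by
      simp only [hQ, Matrix.conjTranspose_mul, hHstar, hPstar, Matrix.mul_assoc]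
    have hQH : Q * H = H * P := by rw [hQ, Matrix.mul_assoc, hHH, mul_one]
    have hQQ : Q * Q = 1 := by
      rw [hQ, ← Matrix.mul_assoc, ← Matrix.mul_assoc, ← hQ, hQH, Matrix.mul_assoc H, hPP,
        mul_one, hHH]
    have hPH : expectation (P * H) η = expectation H η := by
      rw [expectation_eq, ← Matrix.mulVec_mulVec, Matrix.dotProduct_mulVec]
      conv_lhs => rw [← hPstar]
      rw [← Matrix.star_mulVec, hP.2, expectation_eq]
    have hHP : expectation (Q * H) η = expectation H η := by
      rw [hQH, expectation_eq, ← Matrix.mulVec_mulVec, hP.2, expectation_eq]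
    have hsum : expectation ((P + Q) * H) η = 2 * expectation H η := by
      rw [add_mul, expectation_eq, Matrix.add_mulVec, dotProduct_add, ← expectation_eq,
        ← expectation_eq, hPH, hHP, two_mul]
    have hsq : ((P + Q) * H)ᴴ * ((P + Q) * H) = ((2 : ℝ) : ℂ) • 1 := by
      have hT : (P + Q) * (P + Q) = (2 : ℂ) • 1 := by
        rw [add_mul, mul_add, mul_add, hPP, hQQ, h2, two_smul, neg_one_smul]
        abel
      rw [Matrix.conjTranspose_mul, Matrix.conjTranspose_add, hHstar, hPstar, hQstar,
        Matrix.mul_assoc, ← Matrix.mul_assoc (P + Q), hT, Matrix.smul_mul, one_mul,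
        Matrix.mul_smul, hHH]
      simp
    have hb := norm_expectation_sq_le hη.1 hsq
    rw [hsum, norm_mul, mul_pow, Complex.norm_ofNat] at hb
    rw [le_div_iff₀ (by positivity)]
    refine abs_le_of_sq_le_sq' ?_ zero_le_one |>.2
    rw [mul_pow, Real.sq_sqrt (by norm_num)]
    linarith

/-! ### Products of Bell pairs -/

/-- The qubits of an even register, listed in pairs: `(j, b)` is the qubit `2 * j + b`. -/
def pairEquiv {k : ℕ} (hk : Even k) : Fin (k / 2) × Fin 2 ≃ Fin k :=
  finProdFinEquiv.trans (finCongr (Nat.div_mul_cancel hk.two_dvd))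

/-- A sum over all bit strings factors over the pairs of qubits. -/
lemma sum_prod_pairs {k : ℕ} (hk : Even k) (G : Fin (k / 2) → Fin 2 → Fin 2 → ℂ) :
    ∑ y : Fin k → Fin 2, ∏ j, G j (y (pairEquiv hk (j, 0))) (y (pairEquiv hk (j, 1))) =
      ∏ j, ∑ a, ∑ b, G j a b := by
  have h : ∀ j, ∑ a, ∑ b, G j a b = ∑ p : Fin 2 → Fin 2, G j (p 0) (p 1) := fun j => by
    rw [← Fintype.sum_prod_type', ← (finTwoArrowEquiv (Fin 2)).sum_comp]
    rfl
  simp only [h, Finset.prod_univ_sum, Fintype.piFinset_univ]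
  refine Fintype.sum_equiv
    (((pairEquiv hk).symm.arrowCongr (Equiv.refl _)).trans (Equiv.curry _ _ _)) _ _ fun y => ?_
  rfl

lemma prod_pairs {k : ℕ} (hk : Even k) (F : Fin k → ℂ) :
    ∏ i, F i = ∏ j, F (pairEquiv hk (j, 0)) * F (pairEquiv hk (j, 1)) := by
  rw [← (pairEquiv hk).prod_comp, Fintype.prod_prod_type]
  simp only [Fin.prod_univ_two]

lemma bellPair_apply (a b : Fin 2) :
    bellPair ![a, b] = ((1 / Real.sqrt 2 : ℝ) : ℂ) * if a = b then 1 else 0 := by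
  fin_cases a <;> fin_cases b <;> simp [bellPair, ket, funext_iff, Fin.forall_fin_two]

lemma bellPairs_apply {k : ℕ} (hk : Even k) (x : Fin k → Fin 2) :
    bellPairs k hk x =
      ∏ j, ((1 / Real.sqrt 2 : ℝ) : ℂ) *
        if x (pairEquiv hk (j, 0)) = x (pairEquiv hk (j, 1)) then 1 else 0 := by
  simp only [bellPairs, bellPair_apply]
  refine Finset.prod_congr rfl fun j _ => ?_
  have h0 : (⟨2 * j, by omega⟩ : Fin k) = pairEquiv hk (j, 0) := by
    ext; simp [pairEquiv]
  have h1 : (⟨2 * j + 1, by omega⟩ : Fin k) = pairEquiv hk (j, 1) := by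
    ext; simp [pairEquiv, add_comm]
  rw [h0, h1]

/-- The operator acting by `A j` on both qubits of the `j`-th pair. -/
def tensorPairs {k : ℕ} (hk : Even k) (A : Fin (k / 2) → Matrix (Fin 2) (Fin 2) ℂ) :
    Operator k :=
  tensor fun i => A ((pairEquiv hk).symm i).1

/-- `(A ⊗ B) Φ⁺` has coefficient matrix `A Bᵀ / √2`, so `A ⊗ A` fixes `Φ⁺` when `A Aᵀ = 1`. -/
lemma tensorPairs_mulVec_bellPairs {k : ℕ} (hk : Even k)
    {A : Fin (k / 2) → Matrix (Fin 2) (Fin 2) ℂ} (hA : ∀ j, A j * (A j)ᵀ = 1) :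
    tensorPairs hk A *ᵥ (bellPairs k hk).ofLp = (bellPairs k hk).ofLp := by
  ext x
  rw [bellPairs_apply]
  simp only [Matrix.mulVec, dotProduct, bellPairs_apply, tensorPairs, tensor, Matrix.of_apply]
  simp only [prod_pairs hk, Equiv.symm_apply_apply, ← Finset.prod_mul_distrib]
  rw [sum_prod_pairs hk fun j a b => A j (x (pairEquiv hk (j, 0))) a *
    A j (x (pairEquiv hk (j, 1))) b * (((1 / Real.sqrt 2 : ℝ) : ℂ) * if a = b then 1 else 0)]
  refine Finset.prod_congr rfl fun j _ => ?_
  have h := congrFun (congrFun (hA j) (x (pairEquiv hk (j, 0)))) (x (pairEquiv hk (j, 1)))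
  rw [Matrix.mul_apply, Matrix.one_apply] at h
  rw [← h, Finset.mul_sum]
  refine Finset.sum_congr rfl fun a _ => ?_
  simp [mul_comm]

lemma norm_bellPairs {k : ℕ} (hk : Even k) : ‖bellPairs k hk‖ = 1 := by
  have hs : ((Real.sqrt 2 : ℝ) : ℂ)⁻¹ * ((Real.sqrt 2 : ℝ) : ℂ)⁻¹ = 1 / 2 := by
    rw [← mul_inv, ← Complex.ofReal_mul, Real.mul_self_sqrt (by norm_num)]; norm_num
  have h := inner_self_eq_norm_sq_to_K (𝕜 := ℂ) (bellPairs k hk)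
  rw [EuclideanSpace.inner_eq_star_dotProduct] at h
  simp only [dotProduct, Pi.star_apply, bellPairs_apply, star_prod,
    ← Finset.prod_mul_distrib] at h
  rw [sum_prod_pairs hk fun j a b =>
    (((1 / Real.sqrt 2 : ℝ) : ℂ) * if a = b then 1 else 0) *
      star (((1 / Real.sqrt 2 : ℝ) : ℂ) * if a = b then 1 else 0)] at h
  rw [Finset.prod_eq_one fun j _ => by simp [hs]] at h
  have h' : ((‖bellPairs k hk‖ : ℝ) : ℂ) ^ 2 = 1 := h.symm
  exact (pow_eq_one_iff_of_nonneg (norm_nonneg _) two_ne_zero).1 (by exact_mod_cast h')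

/-- The real matrices `X ^ a * Z ^ b`, representing the Pauli matrices up to phase. -/
def realPauli (p : Fin 2 × Fin 2) : Matrix (Fin 2) (Fin 2) ℂ :=
  pauliX ^ (p.1 : ℕ) * pauliZ ^ (p.2 : ℕ)

lemma realPauli_mem (p : Fin 2 × Fin 2) : realPauli p ∈ pauliGroupOne := by
  obtain ⟨a, b⟩ := p
  refine mul_mem_pauliGroupOne (mem_pauliGroupOne ?_) (mem_pauliGroupOne ?_)
  · fin_cases a <;> simp
  · fin_cases b <;> simp

lemma trace_realPauli_mul_transpose (p q : Fin 2 × Fin 2) :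
    (realPauli p * (realPauli q)ᵀ).trace = if p = q then 2 else 0 := by
  obtain ⟨a, b⟩ := p
  obtain ⟨c, d⟩ := q
  fin_cases a <;> fin_cases b <;> fin_cases c <;> fin_cases d <;>
    simp [realPauli, pauliX, pauliZ, Matrix.trace, Fin.sum_univ_two, Matrix.vecMul,
      dotProduct] <;>
    norm_num

lemma realPauli_mul_transpose (p : Fin 2 × Fin 2) : realPauli p * (realPauli p)ᵀ = 1 := by
  have hX : pauliXᵀ = pauliX := by
    ext i j
    fin_cases i <;> fin_cases j <;> simp [pauliX]
  have hZ : pauliZᵀ = pauliZ := by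
    ext i j
    fin_cases i <;> fin_cases j <;> simp [pauliZ]
  obtain ⟨a, b⟩ := p
  fin_cases a <;> fin_cases b <;>
    simp [realPauli, Matrix.transpose_mul, hX, hZ, pauliX_mul_self, pauliZ_mul_self]
  rw [Matrix.mul_assoc, ← Matrix.mul_assoc pauliZ, pauliZ_mul_self, one_mul, pauliX_mul_self]

lemma tensorPairs_realPauli_injective {k : ℕ} (hk : Even k) :
    Function.Injective fun f : Fin (k / 2) → Fin 2 × Fin 2 =>
      tensorPairs hk fun j => realPauli (f j) := by
  intro f g hfg
  by_contra hne
  obtain ⟨j, hj⟩ := Function.ne_iff.1 hne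
  -- Pairing both sides with the operator of `g` in the trace form gives `0 = 2 ^ k`.
  have h := congrArg
    (fun T => (T * tensor fun i => (realPauli (g ((pairEquiv hk).symm i).1))ᵀ).trace) hfg
  simp only [tensorPairs, tensor_mul, trace_tensor, trace_realPauli_mul_transpose] at h
  rw [Finset.prod_eq_zero (Finset.mem_univ (pairEquiv hk (j, 0))) (by simp [hj])] at h
  simp only [if_true, Finset.prod_const] at h
  exact pow_ne_zero _ two_ne_zero h.symm

lemma isStabilizerState_bellPairs {k : ℕ} (hk : Even k) :
    IsStabilizerState (bellPairs k hk) := by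
  refine ⟨norm_bellPairs hk, (ncard_stab_le (norm_bellPairs hk)).antisymm ?_⟩
  have hfin : (stab (bellPairs k hk)).Finite := (finite_pauliGroup k).subset fun P hP => hP.1
  have hsub : Set.range (fun f : Fin (k / 2) → Fin 2 × Fin 2 =>
      tensorPairs hk fun j => realPauli (f j)) ⊆ stab (bellPairs k hk) := by
    rintro _ ⟨f, rfl⟩
    exact ⟨⟨_, fun i => realPauli_mem _, rfl⟩,
      tensorPairs_mulVec_bellPairs hk fun j => realPauli_mul_transpose _⟩
  refine le_trans (le_of_eq ?_) (Set.ncard_le_ncard hsub hfin)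
  rw [← Nat.card_coe_set_eq, Nat.card_range_of_injective (tensorPairs_realPauli_injective hk)]
  simp only [Nat.card_eq_fintype_card, Fintype.card_pi, Fintype.card_prod, Fintype.card_fin,
    Finset.prod_const, Finset.card_univ]
  rw [← pow_two, ← pow_mul, Nat.mul_div_cancel' hk.two_dvd]

lemma expectation_hadamardPower_bellPairs {k : ℕ} (hk : Even k) :
    expectation (hadamardPower k) (bellPairs k hk) = 1 := by
  have h : hadamardPower k *ᵥ (bellPairs k hk).ofLp = (bellPairs k hk).ofLp :=
    tensorPairs_mulVec_bellPairs hk (A := fun _ => hadamard) fun _ => by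
      rw [transpose_hadamard, hadamard_mul_self]
  rw [expectation_eq, h, star_dotProduct_self (norm_bellPairs hk)]

end Stabilizer

theorem lemma3p3 (k : ℕ) :
    (Odd k → ∀ η : Stabilizer.Qubits k, Stabilizer.IsStabilizerState η →
      ‖Stabilizer.expectation (Stabilizer.hadamardPower k) η‖ ≤ 1 / Real.sqrt 2) ∧
    (∀ hk : Even k, ∃ η₀ : Stabilizer.Qubits k,
      η₀ = Stabilizer.bellPairs k hk ∧ Stabilizer.IsStabilizerState η₀ ∧
      Stabilizer.expectation (Stabilizer.hadamardPower k) η₀ = 1) :=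
  ⟨fun hk _ hη => Stabilizer.norm_expectation_hadamardPower_le_of_odd hk hη,
    fun hk => ⟨_, rfl, Stabilizer.isStabilizerState_bellPairs hk,
      Stabilizer.expectation_hadamardPower_bellPairs hk⟩⟩
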